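/- Let $n\ge 1$, $\mu\in\mathbb R$, $\sigma^2>0$, $\beta\ge 0$, and let $G=[g_{ij}]$ and $\widetilde G=[\tilde g_{ij}]$ be the adjacency matrices of two simple undirected graphs on $\{1,\dots,n\}$ (the incentive graph and the synergy graph). The state $\bm x=(x_1,\dots,x_n)$ has law $N(\mu\bm 1_n,\sigma^2 I_n)$. A public signal $\varphi$ is a Markov kernel from $\mathbb R^n$ to an arbitrary measurable space $M$; the agents, who know only the prior, observe its realization $m$ and then choose actions $a_i\in\mathbb R$ that form a Nash equilibrium under the common posterior given $m$, where agent $i$ has payoff \[ u_i(\bm a,\bm x)=-(a_i-x_i)^2-\beta\sum_{j=1}^n g_{ij}(a_i-a_j)^2 . \] The signal is optimal if it maximizes, over all public signals, the ex ante expected equilibrium value of the principal's objective \[ v(\bm a,\bm x)=-\sum_{i=1}^n (a_i-x_i)^2-\beta\sum_{i=1}^n\sum_{j=1}^n\tilde g_{ij}(a_i-a_j)^2 . \] Then an optimal public signal exists, and every optimal public signal $\varphi^*$ informs the agents of the average state $\bar x=\frac1n\sum_{i=1}^n x_i$, that is, $\mathbb E[\bar x\mid m]=\bar x$ almost surely,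 where $m$ is the realization of $\varphi^*$. -/

import Mathlib

open MeasureTheory ProbabilityTheory
open scoped NNReal

universe u

namespace AdaptiveOrg

/-- The profile of local states (or of actions) of `n` agents, a vector of `ℝⁿ`. -/
abbrev Profile (n : ℕ) : Type := Fin n → ℝ

/-- The payoff of agent `i`,
`u_i(a, x) = -(a_i - x_i)² - β ∑_j g_ij (a_i - a_j)²`. -/
noncomputable def agentPayoff {n : ℕ} (g : Matrix (Fin n) (Fin n) ℝ) (β : ℝ) (i : Fin n)
    (a x : Profile n) : ℝ :=
  -(a i - x i) ^ 2 - β * ∑ j, g i j * (a i - a j) ^ 2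

/-- The objective of the principal,
`v(a, x) = -∑_i (a_i - x_i)² - β ∑_i ∑_j g̃_ij (a_i - a_j)²`. -/
noncomputable def principalPayoff {n : ℕ} (gt : Matrix (Fin n) (Fin n) ℝ) (β : ℝ)
    (a x : Profile n) : ℝ :=
  -∑ i, (a i - x i) ^ 2 - β * ∑ i, ∑ j, gt i j * (a i - a j) ^ 2

/-- The common prior `N(μ 1, σ² I)`: the local states are independent `N(μ, σ²)` variables.
The argument `v` is the variance `σ²`. -/
noncomputable def prior (n : ℕ) (μ : ℝ) (v : ℝ≥0) : Measure (Profile n) :=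
  Measure.pi fun _ => gaussianReal μ v

instance instIsProbabilityMeasurePrior (n : ℕ) (μ : ℝ) (v : ℝ≥0) :
    IsProbabilityMeasure (prior n μ v) := by
  unfold prior; infer_instance

/-- The average state `(1/n) ∑_i x_i`. -/
noncomputable def averageState {n : ℕ} (x : Profile n) : ℝ :=
  (1 / (n : ℝ)) * ∑ i, x i

section Signals

/- A public signal with realizations in `M` is a Markov kernel `φ` from `ℝⁿ` to `M`.  With the
prior `P`, the joint law of state and realization is `P ⊗ₘ φ`, the law of the realization is
`φ ∘ₘ P`, and the posterior on the state after the realization `m` is `posterior φ P m`. -/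

variable {n : ℕ} {M : Type*} [MeasurableSpace M]

/-- The measurable strategy profile `a : M → ℝⁿ` is a Nash equilibrium under the public signal `φ`:
after (almost) every realization `m`, no agent can gain in expectation under the common posterior by
a unilateral change of action. -/
def IsEquilibrium (g : Matrix (Fin n) (Fin n) ℝ) (β : ℝ) (P : Measure (Profile n))
    [IsProbabilityMeasure P] (φ : Kernel (Profile n) M) [IsMarkovKernel φ]
    (a : M → Profile n) : Prop :=
  Measurable a ∧
    ∀ᵐ m ∂(φ ∘ₘ P), ∀ (i : Fin n) (b : ℝ),
      ∫ x, agentPayoff g β i (Function.update (a m) i b) x ∂(posterior φ P m) ≤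
        ∫ x, agentPayoff g β i (a m) x ∂(posterior φ P m)

/-- The ex ante expected payoff of the principal when the agents follow `a` under `φ`. -/
noncomputable def expectedPayoff (gt : Matrix (Fin n) (Fin n) ℝ) (β : ℝ) (P : Measure (Profile n))
    (φ : Kernel (Profile n) M) (a : M → Profile n) : ℝ :=
  ∫ p, principalPayoff gt β (a p.2) p.1 ∂(P ⊗ₘ φ)

/-- The signal `φ` informs the agents of `y`: the conditional expectation of `y` given the
realization is well defined and equals `y`, almost surely. -/
def Informs (P : Measure (Profile n)) [IsProbabilityMeasure P]
    (φ : Kernel (Profile n) M) [IsMarkovKernel φ] (y : Profile n → ℝ) : Prop :=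
  ∀ᵐ p ∂(P ⊗ₘ φ), Integrable y (posterior φ P p.2) ∧
    ∫ x, y x ∂(posterior φ P p.2) = y p.1

end Signals

/-- The public signal `φ` is optimal: its equilibrium gives the principal at least the
expected payoff of any equilibrium under any other public signal, with any space of realizations. -/
def IsOptimal {n : ℕ} {M : Type u} [MeasurableSpace M] (g gt : Matrix (Fin n) (Fin n) ℝ)
    (β : ℝ) (P : Measure (Profile n)) [IsProbabilityMeasure P]
    (φ : Kernel (Profile n) M) [IsMarkovKernel φ] : Prop :=
  ∃ a : M → Profile n, IsEquilibrium g β P φ a ∧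
    ∀ (M' : Type u) [MeasurableSpace M'] (ψ : Kernel (Profile n) M') [IsMarkovKernel ψ]
      (b : M' → Profile n), IsEquilibrium g β P ψ b →
        expectedPayoff gt β P ψ b ≤ expectedPayoff gt β P φ a

end AdaptiveOrg

/-! Let `L`, `L̃` be the Laplacians of the two graphs, `B = (1 + βL)⁻¹`, and `y` the posterior mean.
The first order conditions give the almost surely unique equilibrium `a = B y`
(`isEquilibrium_iff`), so the expected payoff is `-E|x|² + E yᵀWy` with `W = 2B - B(1 + 2βL̃)B`
(`expectedPayoff_eq`).

Let `Wp` be the positive part of `W`. Then `E yᵀWy ≤ E yᵀWp y = E xᵀWp x - E (x-y)ᵀWp(x-y)`, which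
bounds every signal's payoff (`expectedPayoff_add_loss_le`). Revealing `Q x`, with `Q` the
projection to the positive eigenspaces of `W`, attains the bound: the Gaussian prior gives `y = Q x`
(`posteriorMean_projectionSignal`), and `QWQ = Wp`.

For any optimal signal the loss vanishes, so `Wp(x-y) = 0` almost surely. Laplacians kill constants,
hence `W1 = 1` and `Wp1 = 1`; pairing with `1` gives `∑ x_i = ∑ y_i`. -/

namespace AdaptiveOrg

open Matrix

/-! ### Spectral calculus and the positive part of a symmetric matrix. -/

section LinearAlgebra

variable {ι : Type*} [Fintype ι] [DecidableEq ι]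

/-- The functional calculus of a matrix with eigenbasis `U`: the eigenvalues are replaced by `d`. -/
def spectralMatrix (U : Matrix ι ι ℝ) (d : ι → ℝ) : Matrix ι ι ℝ := U * diagonal d * Uᵀ

lemma spectralMatrix_mul {U : Matrix ι ι ℝ} (hU : Uᵀ * U = 1) (d e : ι → ℝ) :
    spectralMatrix U d * spectralMatrix U e = spectralMatrix U (d * e) := by
  unfold spectralMatrix
  calc U * diagonal d * Uᵀ * (U * diagonal e * Uᵀ)
      = U * diagonal d * (Uᵀ * U) * diagonal e * Uᵀ := by simp only [Matrix.mul_assoc]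
    _ = U * diagonal (d * e) * Uᵀ := by
        rw [hU, Matrix.mul_one, Matrix.mul_assoc U, diagonal_mul_diagonal]; rfl

lemma spectralMatrix_transpose (U : Matrix ι ι ℝ) (d : ι → ℝ) :
    (spectralMatrix U d)ᵀ = spectralMatrix U d := by
  simp [spectralMatrix, Matrix.mul_assoc]

lemma spectralMatrix_sub (U : Matrix ι ι ℝ) (d e : ι → ℝ) :
    spectralMatrix U d - spectralMatrix U e = spectralMatrix U (d - e) := by
  simp only [spectralMatrix, ← Matrix.sub_mul, ← Matrix.mul_sub, diagonal_sub]
  rfl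

lemma spectralMatrix_posSemidef (U : Matrix ι ι ℝ) {d : ι → ℝ} (hd : 0 ≤ d) :
    (spectralMatrix U d).PosSemidef := by
  simpa [spectralMatrix] using (PosSemidef.diagonal hd).mul_mul_conjTranspose_same U

/-- In eigencoordinates a fixed vector is supported on the indices with `d k = 1`, where `e` is `1`
too. -/
lemma spectralMatrix_mulVec_eq_self {U : Matrix ι ι ℝ} (hU : Uᵀ * U = 1) {d e : ι → ℝ}
    {z : ι → ℝ} (h : spectralMatrix U d *ᵥ z = z) (hde : ∀ k, d k = 1 → e k = 1) :
    spectralMatrix U e *ᵥ z = z := by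
  have hd : diagonal d *ᵥ (Uᵀ *ᵥ z) = Uᵀ *ᵥ z := by
    conv_rhs => rw [← h]
    simp only [spectralMatrix, mulVec_mulVec, ← Matrix.mul_assoc, hU, Matrix.one_mul]
  have he : diagonal e *ᵥ (Uᵀ *ᵥ z) = Uᵀ *ᵥ z := by
    ext k
    have hk := congrFun hd k
    rw [mulVec_diagonal] at hk ⊢
    by_cases h0 : (Uᵀ *ᵥ z) k = 0
    · rw [h0, mul_zero]
    · rw [hde k (mul_right_cancel₀ h0 (hk.trans (one_mul _).symm)), one_mul]
  have hU' : U * Uᵀ = 1 := mul_eq_one_comm.mp hU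
  rw [spectralMatrix, ← mulVec_mulVec, ← mulVec_mulVec, he, mulVec_mulVec, hU', one_mulVec]

/-- The positive part `Wp` of a symmetric matrix `W` that fixes `z`, together with the orthogonal
projection `Q` to the sum of the eigenspaces for positive eigenvalues. -/
lemma exists_positive_part {W : Matrix ι ι ℝ} (hW : Wᵀ = W) {z : ι → ℝ} (hz : W *ᵥ z = z) :
    ∃ Q Wp : Matrix ι ι ℝ, Qᵀ = Q ∧ Q * Q = Q ∧ Q *ᵥ z = z ∧ Wp.PosSemidef ∧
      (Wp - W).PosSemidef ∧ Wp *ᵥ z = z ∧ Q * W * Q = Wp := by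
  have hH : W.IsHermitian := by simpa [IsHermitian] using hW
  let U : Matrix ι ι ℝ := hH.eigenvectorUnitary
  have hU : Uᵀ * U = 1 := by
    simpa [star_eq_conjTranspose] using Unitary.coe_star_mul_self hH.eigenvectorUnitary
  let l : ι → ℝ := hH.eigenvalues
  have hWs : W = spectralMatrix U l := by
    conv_lhs => rw [hH.spectral_theorem]
    simp [spectralMatrix, U, l, star_eq_conjTranspose]
  -- The indicator of the positive eigenvalues. Writing the positive part as `q * l * q` makes `Q *
  -- W * Q = Wp` immediate.
  let q : ι → ℝ := fun k => if 0 < l k then 1 else 0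
  have hq : q * l * q = fun k => max (l k) 0 := by
    ext k
    by_cases h : 0 < l k
    · simp [q, h, h.le]
    · simp [q, h, not_lt.mp h]
  rw [hWs] at hz
  refine ⟨spectralMatrix U q, spectralMatrix U (q * l * q), spectralMatrix_transpose _ _, ?_, ?_,
    ?_, ?_, ?_, ?_⟩
  · rw [spectralMatrix_mul hU]
    congr 1
    ext k
    simp [q]
  · exact spectralMatrix_mulVec_eq_self hU hz fun k hk => by simp [q, hk]
  · refine spectralMatrix_posSemidef U fun k => ?_
    rw [hq]
    exact le_max_right _ _
  · rw [hWs, spectralMatrix_sub]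
    refine spectralMatrix_posSemidef U fun k => ?_
    rw [hq]
    exact sub_nonneg.mpr (le_max_left _ _)
  · exact spectralMatrix_mulVec_eq_self hU hz fun k hk => by simp [q, hk]
  · rw [hWs, spectralMatrix_mul hU, spectralMatrix_mul hU]

end LinearAlgebra

/-! ### Payoffs as quadratic forms. -/

section Payoffs

variable {n : ℕ}

/-- The matrix `I + βL` of the first order conditions of the agents. -/
noncomputable def bestResponseMatrix (G : SimpleGraph (Fin n)) [DecidableRel G.Adj] (β : ℝ) :
    Matrix (Fin n) (Fin n) ℝ := 1 + β • G.lapMatrix ℝ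

variable (G Gt : SimpleGraph (Fin n)) [DecidableRel G.Adj] [DecidableRel Gt.Adj] {β : ℝ}

lemma bestResponseMatrix_transpose : (bestResponseMatrix G β)ᵀ = bestResponseMatrix G β := by
  simp [bestResponseMatrix, (G.isSymm_lapMatrix ℝ).eq]

lemma bestResponseMatrix_isUnit_det (hβ : 0 ≤ β) : IsUnit (bestResponseMatrix G β).det :=
  (isUnit_iff_isUnit_det _).mp
    (PosDef.one.add_posSemidef ((G.posSemidef_lapMatrix ℝ).smul hβ)).isUnit

lemma bestResponseMatrix_mulVec_one :
    bestResponseMatrix G β *ᵥ (fun _ => 1) = fun _ => 1 := by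
  rw [bestResponseMatrix, add_mulVec, smul_mulVec, G.lapMatrix_mulVec_const_eq_zero]
  simp

lemma bestResponseMatrix_mulVec_apply (a : Profile n) (i : Fin n) :
    (bestResponseMatrix G β *ᵥ a) i = a i + β * ∑ j, G.adjMatrix ℝ i j * (a i - a j) := by
  rw [bestResponseMatrix, add_mulVec, smul_mulVec, one_mulVec, Pi.add_apply, Pi.smul_apply,
    SimpleGraph.lapMatrix_mulVec_apply, smul_eq_mul, SimpleGraph.degree_eq_sum_if_adj,
    ← SimpleGraph.adjMatrix_mulVec_apply]
  simp only [mul_sub, Finset.sum_sub_distrib, SimpleGraph.adjMatrix_apply, Finset.sum_mul,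
    mulVec, dotProduct]

/-- The factor `2 * β` arises because the double sum counts each edge twice, while the Laplacian
form counts it once. -/
lemma principalPayoff_eq (a x : Profile n) :
    principalPayoff (Gt.adjMatrix ℝ) β a x =
      -(x ⬝ᵥ x) + 2 * (a ⬝ᵥ x) - a ⬝ᵥ ((1 + (2 * β) • Gt.lapMatrix ℝ) *ᵥ a) := by
  have h := Gt.lapMatrix_toLinearMap₂' ℝ a
  rw [toLinearMap₂'_apply'] at h
  rw [add_mulVec, smul_mulVec, one_mulVec, dotProduct_add, dotProduct_smul, h, principalPayoff]
  have h1 : ∑ i, (a i - x i) ^ 2 = a ⬝ᵥ a - 2 * (a ⬝ᵥ x) + x ⬝ᵥ x := by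
    simp only [dotProduct, Finset.mul_sum, ← Finset.sum_sub_distrib, ← Finset.sum_add_distrib]
    exact Finset.sum_congr rfl fun i _ => by ring
  rw [h1]
  simp only [SimpleGraph.adjMatrix_apply, ite_mul, one_mul, zero_mul, smul_eq_mul]
  ring

/-- The quadratic form in the posterior mean that gives the expected payoff of the principal. -/
noncomputable def valueMatrix (β : ℝ) : Matrix (Fin n) (Fin n) ℝ :=
  (2 : ℝ) • (bestResponseMatrix G β)⁻¹ -
    (bestResponseMatrix G β)⁻¹ * (1 + (2 * β) • Gt.lapMatrix ℝ) * (bestResponseMatrix G β)⁻¹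

lemma bestResponseMatrix_inv_transpose :
    ((bestResponseMatrix G β)⁻¹)ᵀ = (bestResponseMatrix G β)⁻¹ := by
  rw [transpose_nonsing_inv, bestResponseMatrix_transpose]

lemma valueMatrix_transpose : (valueMatrix G Gt β)ᵀ = valueMatrix G Gt β := by
  simp [valueMatrix, bestResponseMatrix_inv_transpose, (Gt.isSymm_lapMatrix ℝ).eq,
    Matrix.mul_assoc]

/-- Both Laplacians kill constants, so the eigenvalue is `2 - 1 = 1`. Its positivity, whatever the
graphs, is why the average state is always disclosed. -/
lemma valueMatrix_mulVec_one (hβ : 0 ≤ β) :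
    valueMatrix G Gt β *ᵥ (fun _ => 1) = fun _ => 1 := by
  have h : (bestResponseMatrix G β)⁻¹ *ᵥ (fun _ => 1) = fun _ => 1 := by
    conv_lhs => rw [← bestResponseMatrix_mulVec_one G (β := β)]
    rw [mulVec_mulVec, nonsing_inv_mul _ (bestResponseMatrix_isUnit_det G hβ), one_mulVec]
  rw [valueMatrix, sub_mulVec, ← mulVec_mulVec, ← mulVec_mulVec, h, add_mulVec, smul_mulVec,
    smul_mulVec, Gt.lapMatrix_mulVec_const_eq_zero, one_mulVec, smul_zero, add_zero, h]
  ext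
  norm_num

lemma dotProduct_valueMatrix (y : Profile n) :
    2 * (((bestResponseMatrix G β)⁻¹ *ᵥ y) ⬝ᵥ y) - ((bestResponseMatrix G β)⁻¹ *ᵥ y) ⬝ᵥ
        ((1 + (2 * β) • Gt.lapMatrix ℝ) *ᵥ ((bestResponseMatrix G β)⁻¹ *ᵥ y)) =
      y ⬝ᵥ (valueMatrix G Gt β *ᵥ y) := by
  rw [valueMatrix, sub_mulVec, dotProduct_sub, ← mulVec_mulVec, ← mulVec_mulVec,
    dotProduct_mulVec y (bestResponseMatrix G β)⁻¹ ((1 + (2 * β) • Gt.lapMatrix ℝ) *ᵥ _),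
    ← mulVec_transpose, bestResponseMatrix_inv_transpose, smul_mulVec, dotProduct_smul,
    dotProduct_comm y]
  simp

/-- A strictly concave quadratic function is maximal where its derivative vanishes. -/
lemma quadratic_le_iff {c d : ℝ} (hc : 0 < c) :
    (∀ t : ℝ, d * t - c * t ^ 2 ≤ 0) ↔ d = 0 := by
  constructor
  · intro h
    -- The vertex of the parabola, with value `d ^ 2 / (4 * c)`.
    have h1 := h (d / (2 * c))
    have h2 : d * (d / (2 * c)) - c * (d / (2 * c)) ^ 2 = d ^ 2 / (4 * c) := by
      field_simp; ring
    rw [h2] at h1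
    have h3 : d ^ 2 ≤ 0 := by
      by_contra! h4
      exact absurd h1 (not_le.mpr (by positivity))
    exact pow_eq_zero_iff two_ne_zero |>.mp (le_antisymm h3 (sq_nonneg d))
  · rintro rfl t
    nlinarith [mul_nonneg hc.le (sq_nonneg t)]

/-- The exact second order expansion in the agent's own action: the slope is the residual of the
first order condition, and the curvature does not depend on the state. -/
lemma agentPayoff_update_sub (a x : Profile n) (i : Fin n) (b : ℝ) :
    agentPayoff (G.adjMatrix ℝ) β i (Function.update a i b) x =
      agentPayoff (G.adjMatrix ℝ) β i a x +
        (2 * (x i - (bestResponseMatrix G β *ᵥ a) i) * (b - a i) -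
          (1 + β * ∑ j, G.adjMatrix ℝ i j) * (b - a i) ^ 2) := by
  have h : ∀ j, G.adjMatrix ℝ i j * (Function.update a i b i - Function.update a i b j) ^ 2 =
      G.adjMatrix ℝ i j * (a i - a j) ^ 2
        + 2 * (b - a i) * (G.adjMatrix ℝ i j * (a i - a j))
        + (b - a i) ^ 2 * G.adjMatrix ℝ i j := by
    intro j
    rcases eq_or_ne j i with rfl | hj
    -- Here the absence of loops is needed: the last term on the right carries the diagonal entry of
    -- the adjacency matrix.
    · simp
    · rw [Function.update_self, Function.update_of_ne hj]; ring
  rw [agentPayoff, Finset.sum_congr rfl fun j _ => h j, Finset.sum_add_distrib,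
    Finset.sum_add_distrib, ← Finset.mul_sum, ← Finset.mul_sum, Function.update_self,
    agentPayoff, bestResponseMatrix_mulVec_apply]
  ring

end Payoffs

/-! ### Integrability of quadratic forms. -/

section QuadraticForms

variable {α : Type*} [MeasurableSpace α] {ρ : Measure α} {n : ℕ} {z w : α → Profile n}

lemma integrable_dotProduct (hz : ∀ i, MemLp (fun p => z p i) 2 ρ)
    (hw : ∀ i, MemLp (fun p => w p i) 2 ρ) : Integrable (fun p => z p ⬝ᵥ w p) ρ :=
  integrable_finsetSum _ fun i _ => (hz i).integrable_mul (hw i)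

lemma memLp_mulVec (A : Matrix (Fin n) (Fin n) ℝ) (hz : ∀ i, MemLp (fun p => z p i) 2 ρ)
    (i : Fin n) : MemLp (fun p => (A *ᵥ z p) i) 2 ρ :=
  memLp_finsetSum Finset.univ fun j _ => (hz j).const_mul (A i j)

end QuadraticForms

lemma measurable_mulVec {n : ℕ} (A : Matrix (Fin n) (Fin n) ℝ) :
    Measurable fun x : Profile n => A *ᵥ x := by
  unfold mulVec dotProduct
  fun_prop

/-! ### Posterior means, equilibria and expected payoffs. -/

section Posterior

variable {n : ℕ} {M : Type*} [MeasurableSpace M] {P : Measure (Profile n)}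
  [IsProbabilityMeasure P] {φ : Kernel (Profile n) M} [IsMarkovKernel φ]

/-- The posterior mean of the state after the realization `m`. -/
noncomputable def posteriorMean (P : Measure (Profile n)) [IsProbabilityMeasure P]
    (φ : Kernel (Profile n) M) [IsMarkovKernel φ] (m : M) : Profile n :=
  fun i => ∫ x, x i ∂(posterior φ P m)

lemma measurable_posteriorMean : Measurable (posteriorMean P φ) :=
  measurable_pi_lambda _ fun i =>
    (StronglyMeasurable.integral_kernel (κ := posterior φ P)
      (measurable_pi_apply i).stronglyMeasurable).measurable

lemma ae_compProd_of_ae_comp {p : M → Prop} (h : ∀ᵐ m ∂(φ ∘ₘ P), p m) :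
    ∀ᵐ q ∂(P ⊗ₘ φ), p q.2 := by
  rw [← Measure.snd_compProd] at h
  exact ae_of_ae_map measurable_snd.aemeasurable h

lemma integral_compProd_snd {f : M → ℝ} (hf : Measurable f) :
    ∫ q, f q.2 ∂(P ⊗ₘ φ) = ∫ m, f m ∂(φ ∘ₘ P) := by
  rw [← Measure.snd_compProd, Measure.snd,
    integral_map measurable_snd.aemeasurable hf.aestronglyMeasurable]

lemma measurePreserving_swap_posterior :
    MeasurePreserving Prod.swap (P ⊗ₘ φ) ((φ ∘ₘ P) ⊗ₘ posterior φ P) :=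
  ⟨measurable_swap, compProd_posterior_eq_map_swap.symm⟩

lemma measurePreserving_fst_compProd : MeasurePreserving Prod.fst (P ⊗ₘ φ) P :=
  ⟨measurable_fst, Measure.fst_compProd P φ⟩

lemma measurePreserving_snd_posterior :
    MeasurePreserving Prod.snd ((φ ∘ₘ P) ⊗ₘ posterior φ P) P :=
  ⟨measurable_snd, by
    rw [compProd_posterior_eq_map_swap, Measure.map_map measurable_snd measurable_swap]
    exact measurePreserving_fst_compProd.map_eq⟩

lemma integral_compProd_fst {f : Profile n → ℝ} (hf : AEStronglyMeasurable f P) :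
    ∫ q, f q.1 ∂(P ⊗ₘ φ) = ∫ x, f x ∂P := by
  have h := measurePreserving_fst_compProd (P := P) (φ := φ)
  conv_rhs => rw [← h.map_eq]
  rw [integral_map measurable_fst.aemeasurable (by rwa [h.map_eq])]

lemma memLp_fst (hP : ∀ i, MemLp (fun x : Profile n => x i) 2 P) (i : Fin n) :
    MemLp (fun q : Profile n × M => q.1 i) 2 (P ⊗ₘ φ) :=
  (hP i).comp_measurePreserving measurePreserving_fst_compProd

/-- By Fubini for the disintegration of the joint law along the realization. -/
lemma memLp_posterior (hP : ∀ i, MemLp (fun x : Profile n => x i) 2 P) :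
    ∀ᵐ m ∂(φ ∘ₘ P), ∀ i, MemLp (fun x : Profile n => x i) 2 (posterior φ P m) := by
  rw [ae_all_iff]
  intro i
  have h : Integrable (fun q : M × Profile n => q.2 i ^ 2) ((φ ∘ₘ P) ⊗ₘ posterior φ P) :=
    ((hP i).comp_measurePreserving measurePreserving_snd_posterior).integrable_sq
  filter_upwards [((Measure.integrable_compProd_iff h.aestronglyMeasurable).mp h).1] with m hm
  exact (memLp_two_iff_integrable_sq (measurable_pi_apply i).aestronglyMeasurable).mpr hm

lemma sq_integral_le {Ω : Type*} [MeasurableSpace Ω] {ρ : Measure Ω} [IsProbabilityMeasure ρ]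
    {f : Ω → ℝ} (hf : MemLp f 2 ρ) : (∫ x, f x ∂ρ) ^ 2 ≤ ∫ x, f x ^ 2 ∂ρ := by
  have h := variance_nonneg f ρ
  rw [variance_eq_sub hf] at h
  simpa using h

/-- Conditional Jensen: the squared posterior mean is at most the posterior second moment, which is
integrable. -/
lemma memLp_posteriorMean (hP : ∀ i, MemLp (fun x : Profile n => x i) 2 P) (i : Fin n) :
    MemLp (fun q : Profile n × M => posteriorMean P φ q.2 i) 2 (P ⊗ₘ φ) := by
  have hm : Measurable fun m => posteriorMean P φ m i :=
    (measurable_pi_apply i).comp measurable_posteriorMean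
  have h : MemLp (fun m => posteriorMean P φ m i) 2 (φ ∘ₘ P) := by
    have hs : Integrable (fun q : M × Profile n => q.2 i ^ 2) ((φ ∘ₘ P) ⊗ₘ posterior φ P) :=
      ((hP i).comp_measurePreserving measurePreserving_snd_posterior).integrable_sq
    rw [memLp_two_iff_integrable_sq hm.aestronglyMeasurable]
    refine ((Measure.integrable_compProd_iff hs.aestronglyMeasurable).mp hs).2.mono'
      (hm.pow_const 2).aestronglyMeasurable ?_
    filter_upwards [memLp_posterior hP] with m hm
    simpa [posteriorMean] using sq_integral_le (hm i)
  exact h.comp_measurePreserving ⟨measurable_snd, Measure.snd_compProd P φ⟩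

/-- The projection property of the posterior mean. -/
lemma integral_mul_fst_eq {f : M → ℝ} (hf : Measurable f)
    (hfL : MemLp (fun q : Profile n × M => f q.2) 2 (P ⊗ₘ φ))
    (hP : ∀ i, MemLp (fun x : Profile n => x i) 2 P) (i : Fin n) :
    ∫ q, f q.2 * q.1 i ∂(P ⊗ₘ φ) = ∫ q, f q.2 * posteriorMean P φ q.2 i ∂(P ⊗ₘ φ) := by
  have hint : Integrable (fun q : M × Profile n => f q.1 * q.2 i)
      ((φ ∘ₘ P) ⊗ₘ posterior φ P) := by
    rw [← measurePreserving_swap_posterior.integrable_comp (by fun_prop)]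
    exact hfL.integrable_mul (memLp_fst hP i)
  have hm : Measurable fun m => posteriorMean P φ m i :=
    (measurable_pi_apply i).comp measurable_posteriorMean
  -- Disintegrating along the realization lets `f m` leave the inner integral.
  calc ∫ q, f q.2 * q.1 i ∂(P ⊗ₘ φ)
      = ∫ q : M × Profile n, f q.1 * q.2 i ∂((φ ∘ₘ P) ⊗ₘ posterior φ P) := by
        rw [← measurePreserving_swap_posterior.map_eq,
          integral_map measurable_swap.aemeasurable
            (Measurable.aestronglyMeasurable (by fun_prop))]
        rfl
    _ = ∫ m, f m * posteriorMean P φ m i ∂(φ ∘ₘ P) := by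
        rw [Measure.integral_compProd hint]
        simp only [integral_const_mul, posteriorMean]
    _ = _ := (integral_compProd_snd (hf.mul hm)).symm

lemma integral_dotProduct_fst_eq (hP : ∀ i, MemLp (fun x : Profile n => x i) 2 P)
    (A : Matrix (Fin n) (Fin n) ℝ) :
    ∫ q, (A *ᵥ posteriorMean P φ q.2) ⬝ᵥ q.1 ∂(P ⊗ₘ φ) =
      ∫ q, (A *ᵥ posteriorMean P φ q.2) ⬝ᵥ posteriorMean P φ q.2 ∂(P ⊗ₘ φ) := by
  have hA := memLp_mulVec A (memLp_posteriorMean (φ := φ) hP)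
  simp only [dotProduct]
  have h1 : ∀ i ∈ Finset.univ, Integrable (fun q : Profile n × M =>
      (A *ᵥ posteriorMean P φ q.2) i * q.1 i) (P ⊗ₘ φ) :=
    fun i _ => (hA i).integrable_mul (memLp_fst hP i)
  have h2 : ∀ i ∈ Finset.univ, Integrable (fun q : Profile n × M =>
      (A *ᵥ posteriorMean P φ q.2) i * posteriorMean P φ q.2 i) (P ⊗ₘ φ) :=
    fun i _ => (hA i).integrable_mul (memLp_posteriorMean hP i)
  rw [integral_finsetSum _ h1, integral_finsetSum _ h2]
  refine Finset.sum_congr rfl fun i _ => integral_mul_fst_eq (f := fun m =>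
    (A *ᵥ posteriorMean P φ m) i) ?_ (hA i) hP i
  exact (measurable_pi_apply i).comp ((measurable_mulVec A).comp measurable_posteriorMean)

/-- The loss in a quadratic form when the state is replaced by its posterior mean. -/
lemma integral_quadratic_sub (hP : ∀ i, MemLp (fun x : Profile n => x i) 2 P)
    {A : Matrix (Fin n) (Fin n) ℝ} (hA : Aᵀ = A) :
    ∫ q, (q.1 - posteriorMean P φ q.2) ⬝ᵥ (A *ᵥ (q.1 - posteriorMean P φ q.2)) ∂(P ⊗ₘ φ) =
      ∫ x, x ⬝ᵥ (A *ᵥ x) ∂P -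
        ∫ q, posteriorMean P φ q.2 ⬝ᵥ (A *ᵥ posteriorMean P φ q.2) ∂(P ⊗ₘ φ) := by
  have hX := memLp_fst (φ := φ) hP
  have hY := memLp_posteriorMean (φ := φ) hP
  have hs : ∀ x y : Profile n, (x - y) ⬝ᵥ (A *ᵥ (x - y)) =
      x ⬝ᵥ (A *ᵥ x) - 2 * ((A *ᵥ y) ⬝ᵥ x) + y ⬝ᵥ (A *ᵥ y) := by
    intro x y
    have h : y ⬝ᵥ (A *ᵥ x) = (A *ᵥ y) ⬝ᵥ x := by
      rw [dotProduct_mulVec, ← mulVec_transpose, hA]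
    rw [mulVec_sub, sub_dotProduct, dotProduct_sub, dotProduct_sub, h,
      dotProduct_comm x (A *ᵥ y)]
    ring
  have h1 := integrable_dotProduct hX (memLp_mulVec A hX)
  have h2 := integrable_dotProduct (memLp_mulVec A hY) hX
  have h3 := integrable_dotProduct hY (memLp_mulVec A hY)
  have hX' : ∫ q, q.1 ⬝ᵥ (A *ᵥ q.1) ∂(P ⊗ₘ φ) = ∫ x, x ⬝ᵥ (A *ᵥ x) ∂P :=
    integral_compProd_fst (integrable_dotProduct hP (memLp_mulVec A hP)).aestronglyMeasurable
  have h12 : Integrable (fun q : Profile n × M => q.1 ⬝ᵥ (A *ᵥ q.1) -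
      2 * ((A *ᵥ posteriorMean P φ q.2) ⬝ᵥ q.1)) (P ⊗ₘ φ) := h1.sub (h2.const_mul 2)
  simp only [hs]
  -- By projection the cross term integrates to `-2` times the form at the posterior mean, which
  -- with the last term leaves `-1`.
  rw [integral_add h12 h3, integral_sub h1 (h2.const_mul 2),
    integral_const_mul, integral_dotProduct_fst_eq hP, hX']
  simp only [dotProduct_comm (A *ᵥ _)]
  ring

/-- Equilibria are the solutions of the linear first order conditions. -/
lemma isEquilibrium_iff (G : SimpleGraph (Fin n)) [DecidableRel G.Adj] {β : ℝ} (hβ : 0 ≤ β)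
    (hP : ∀ i, MemLp (fun x : Profile n => x i) 2 P) (a : M → Profile n) :
    IsEquilibrium (G.adjMatrix ℝ) β P φ a ↔
      Measurable a ∧ ∀ᵐ m ∂(φ ∘ₘ P), bestResponseMatrix G β *ᵥ a m = posteriorMean P φ m := by
  refine and_congr_right fun _ => Filter.eventually_congr ?_
  filter_upwards [memLp_posterior hP] with m hm
  rw [funext_iff]
  refine forall_congr' fun i => ?_
  have hc : 0 < 1 + β * ∑ j, G.adjMatrix ℝ i j := by
    have : 0 ≤ ∑ j, G.adjMatrix ℝ i j := Finset.sum_nonneg fun j _ => by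
      rw [SimpleGraph.adjMatrix_apply]; split_ifs <;> norm_num
    positivity
  have hx : Integrable (fun x : Profile n => x i) (posterior φ P m) :=
    (hm i).integrable one_le_two
  have hpay : Integrable (fun x => agentPayoff (G.adjMatrix ℝ) β i (a m) x)
      (posterior φ P m) :=
    (((memLp_const (a m i)).sub (hm i)).integrable_sq.neg).sub (integrable_const _)
  -- The state enters the gain from deviating linearly, so averaging it leaves only the posterior
  -- mean.
  have key : ∀ b : ℝ, ∫ x, agentPayoff (G.adjMatrix ℝ) β i (Function.update (a m) i b) x
        ∂(posterior φ P m) =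
      ∫ x, agentPayoff (G.adjMatrix ℝ) β i (a m) x ∂(posterior φ P m) +
        (2 * (posteriorMean P φ m i - (bestResponseMatrix G β *ᵥ a m) i) * (b - a m i) -
          (1 + β * ∑ j, G.adjMatrix ℝ i j) * (b - a m i) ^ 2) := by
    intro b
    have hlin : Integrable (fun x : Profile n =>
        2 * (x i - (bestResponseMatrix G β *ᵥ a m) i) * (b - a m i)) (posterior φ P m) :=
      ((hx.sub (integrable_const _)).const_mul 2).mul_const _
    simp only [agentPayoff_update_sub]
    have hquad : Integrable (fun x : Profile n =>
        2 * (x i - (bestResponseMatrix G β *ᵥ a m) i) * (b - a m i) -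
          (1 + β * ∑ j, G.adjMatrix ℝ i j) * (b - a m i) ^ 2) (posterior φ P m) :=
      hlin.sub (integrable_const _)
    rw [integral_add hpay hquad, integral_sub hlin (integrable_const _),
      integral_mul_const, integral_const_mul, integral_sub hx (integrable_const _)]
    simp [posteriorMean]
  simp only [key, add_le_iff_nonpos_right]
  have hq := quadratic_le_iff (d := 2 * (posteriorMean P φ m i - (bestResponseMatrix G β *ᵥ a m) i))
    hc
  constructor
  · intro h
    have := hq.mp fun t => by simpa using h (a m i + t)
    linarith
  · intro h b
    exact hq.mpr (by rw [h]; ring) (b - a m i)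

/-- The expected payoff of the principal is a quadratic form in the posterior mean. -/
lemma expectedPayoff_eq (G Gt : SimpleGraph (Fin n)) [DecidableRel G.Adj] [DecidableRel Gt.Adj]
    {β : ℝ} (hβ : 0 ≤ β) (hP : ∀ i, MemLp (fun x : Profile n => x i) 2 P) {a : M → Profile n}
    (ha : IsEquilibrium (G.adjMatrix ℝ) β P φ a) :
    expectedPayoff (Gt.adjMatrix ℝ) β P φ a =
      -∫ x, x ⬝ᵥ x ∂P +
        ∫ q, posteriorMean P φ q.2 ⬝ᵥ (valueMatrix G Gt β *ᵥ posteriorMean P φ q.2)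
          ∂(P ⊗ₘ φ) := by
  have hX := memLp_fst (φ := φ) hP
  have hY := memLp_posteriorMean (φ := φ) hP
  set B := (bestResponseMatrix G β)⁻¹ with hB
  have hae : ∀ᵐ q ∂(P ⊗ₘ φ), a q.2 = B *ᵥ posteriorMean P φ q.2 := by
    filter_upwards [ae_compProd_of_ae_comp ((isEquilibrium_iff G hβ hP a).mp ha).2] with q hq
    rw [← hq, mulVec_mulVec, nonsing_inv_mul _ (bestResponseMatrix_isUnit_det G hβ), one_mulVec]
  have hBY := memLp_mulVec B hY
  have h1 := integrable_dotProduct hX hX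
  have h2 := integrable_dotProduct hBY hX
  have h2' := integrable_dotProduct hBY hY
  have h3 := integrable_dotProduct hBY (memLp_mulVec (1 + (2 * β) • Gt.lapMatrix ℝ) hBY)
  have hX' : ∫ q, q.1 ⬝ᵥ q.1 ∂(P ⊗ₘ φ) = ∫ x, x ⬝ᵥ x ∂P :=
    integral_compProd_fst (integrable_dotProduct hP hP).aestronglyMeasurable
  have h12 : Integrable (fun q : Profile n × M => -(q.1 ⬝ᵥ q.1) +
      2 * ((B *ᵥ posteriorMean P φ q.2) ⬝ᵥ q.1)) (P ⊗ₘ φ) := h1.neg.add (h2.const_mul 2)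
  have hpay : ∀ᵐ q ∂(P ⊗ₘ φ), principalPayoff (Gt.adjMatrix ℝ) β (a q.2) q.1 =
      -(q.1 ⬝ᵥ q.1) + 2 * ((B *ᵥ posteriorMean P φ q.2) ⬝ᵥ q.1) -
        (B *ᵥ posteriorMean P φ q.2) ⬝ᵥ
          ((1 + (2 * β) • Gt.lapMatrix ℝ) *ᵥ (B *ᵥ posteriorMean P φ q.2)) :=
    hae.mono fun q hq => by rw [hq, principalPayoff_eq]
  rw [expectedPayoff, integral_congr_ae hpay, integral_sub h12 h3,
    integral_add (by exact h1.neg) (h2.const_mul 2), integral_neg, integral_const_mul, integral_dotProduct_fst_eq hP, hX', add_sub_assoc,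
    ← integral_const_mul, ← integral_sub (h2'.const_mul 2) h3]
  simp only [hB, dotProduct_valueMatrix]

end Posterior

/-! ### Symmetries of the Gaussian prior. -/

section GaussianPrior

variable {n : ℕ} {μ : ℝ} {v : ℝ≥0}

lemma memLp_prior (i : Fin n) : MemLp (fun x : Profile n => x i) 2 (prior n μ v) :=
  (memLp_id_gaussianReal (μ := μ) (v := v) 2).comp_measurePreserving
    (measurePreserving_eval (fun _ : Fin n => gaussianReal μ v) i)

/-- Rotation invariance of the standard Gaussian on `EuclideanSpace`, transported to the plain
product. -/
lemma pi_gaussianReal_map_mulVec {R : Matrix (Fin n) (Fin n) ℝ} (hR : Rᵀ * R = 1) :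
    (Measure.pi fun _ : Fin n => gaussianReal 0 1).map (R *ᵥ ·) =
      Measure.pi fun _ : Fin n => gaussianReal 0 1 := by
  let f : EuclideanSpace ℝ (Fin n) →ₗᵢ[ℝ] EuclideanSpace ℝ (Fin n) :=
    { toLpLin 2 2 R with
      norm_map' := fun x => by
        have h : (WithLp.ofLp x) ⬝ᵥ (WithLp.ofLp x) =
            (R *ᵥ WithLp.ofLp x) ⬝ᵥ (R *ᵥ WithLp.ofLp x) := by
          rw [dotProduct_mulVec, ← mulVec_transpose, mulVec_mulVec, hR, one_mulVec]
        simp only [dotProduct] at h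
        simp [EuclideanSpace.norm_eq, sq, h] }
  have hf := stdGaussian_map (f.toLinearIsometryEquiv rfl)
  rw [← map_pi_eq_stdGaussian, Measure.map_map (by fun_prop) (by fun_prop)] at hf
  have hf' := congrArg (Measure.map (WithLp.ofLp : EuclideanSpace ℝ (Fin n) → Fin n → ℝ)) hf
  rw [Measure.map_map (by fun_prop) (by fun_prop),
    Measure.map_map (by fun_prop) (by fun_prop)] at hf'
  exact hf'.trans Measure.map_id

lemma prior_eq_map :
    prior n μ v = (Measure.pi fun _ : Fin n => gaussianReal 0 1).map
      fun x => (fun _ => μ) + (√v : ℝ) • x := by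
  have h : gaussianReal μ v = (gaussianReal 0 1).map fun x => μ + (√v : ℝ) * x := by
    have h1 := gaussianReal_map_const_mul (μ := 0) (v := 1) (√v : ℝ)
    have h2 := gaussianReal_map_const_add (μ := 0) (v := v) μ
    have h3 : (.mk ((√v : ℝ) ^ 2) (sq_nonneg _) * 1 : ℝ≥0) = v := by
      ext
      simp
    rw [mul_zero, h3] at h1
    rw [zero_add, ← h1, Measure.map_map (by fun_prop) (by fun_prop)] at h2
    exact h2.symm
  have : ∀ _ : Fin n, IsProbabilityMeasure ((gaussianReal 0 1).map fun x => μ + (√v : ℝ) * x) :=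
    fun _ => Measure.isProbabilityMeasure_map (by fun_prop)
  rw [prior, h, ← Measure.pi_map_pi fun _ => by fun_prop]
  rfl

/-- The prior is invariant under the orthogonal maps that fix the constant profiles. -/
lemma measurePreserving_mulVec_prior {R : Matrix (Fin n) (Fin n) ℝ} (hR : Rᵀ * R = 1)
    (hR1 : R *ᵥ (fun _ => 1) = fun _ => 1) :
    MeasurePreserving (R *ᵥ ·) (prior n μ v) (prior n μ v) := by
  refine ⟨measurable_mulVec R, ?_⟩
  have hμ : R *ᵥ (fun _ => μ) = fun _ => μ := by
    have h : (fun _ : Fin n => μ) = μ • fun _ => 1 := by ext; simp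
    rw [h, mulVec_smul, hR1]
  rw [prior_eq_map, Measure.map_map (measurable_mulVec R) (by fun_prop)]
  conv_rhs => rw [← pi_gaussianReal_map_mulVec hR,
    Measure.map_map (by fun_prop) (measurable_mulVec R)]
  congr 1
  ext x : 1
  simp only [Function.comp_apply, mulVec_add, mulVec_smul, hμ]

/-- Under the prior, the projection `Q x` is the conditional expectation of the state given itself,
if `Q` fixes the constant profiles. -/
lemma integral_projection_prior {Q : Matrix (Fin n) (Fin n) ℝ} (hQ : Qᵀ = Q) (hQQ : Q * Q = Q)
    (hQ1 : Q *ᵥ (fun _ => 1) = fun _ => 1) {f : Profile n → ℝ} (hf : Measurable f)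
    (hfL : MemLp (fun x => f (Q *ᵥ x)) 2 (prior n μ v)) (i : Fin n) :
    ∫ x, f (Q *ᵥ x) * x i ∂(prior n μ v) = ∫ x, f (Q *ᵥ x) * (Q *ᵥ x) i ∂(prior n μ v) := by
  -- The reflection across the range of `Q` preserves the prior, keeps `Q x` and sends `x` to `2 Q x
  -- - x`. Changing variables by it gives `E f x = 2 E f Qx - E f x`.
  let R : Matrix (Fin n) (Fin n) ℝ := (2 : ℝ) • Q - 1
  have hRt : Rᵀ = R := by simp [R, hQ]
  have hR : Rᵀ * R = 1 := by
    rw [hRt]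
    simp only [R, sub_mul, mul_sub, smul_mul_smul_comm, hQQ, mul_one, one_mul]
    module
  have hR1 : R *ᵥ (fun _ => 1) = fun _ => 1 := by
    rw [sub_mulVec, smul_mulVec, hQ1, one_mulVec]
    ext
    norm_num
  have hQR : ∀ x, Q *ᵥ (R *ᵥ x) = Q *ᵥ x := by
    intro x
    rw [mulVec_mulVec]
    congr 1
    simp only [R, mul_sub, mul_smul_comm, hQQ, mul_one]
    module
  have hRi : ∀ x : Profile n, (R *ᵥ x) i = 2 * (Q *ᵥ x) i - x i := by
    intro x
    rw [sub_mulVec, smul_mulVec, one_mulVec]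
    rfl
  have hmp := measurePreserving_mulVec_prior (μ := μ) (v := v) hR hR1
  have hfQ : Measurable fun x => f (Q *ᵥ x) := hf.comp (measurable_mulVec Q)
  have h1 : ∫ x, f (Q *ᵥ x) * x i ∂(prior n μ v) =
      ∫ x, 2 * (f (Q *ᵥ x) * (Q *ᵥ x) i) - f (Q *ᵥ x) * x i ∂(prior n μ v) := by
    conv_lhs => rw [← hmp.map_eq]
    rw [integral_map hmp.measurable.aemeasurable
      (Measurable.aestronglyMeasurable (by fun_prop))]
    refine integral_congr_ae (.of_forall fun x => ?_)
    simp only [hQR, hRi]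
    ring
  have i1 : Integrable (fun x => f (Q *ᵥ x) * (Q *ᵥ x) i) (prior n μ v) :=
    hfL.integrable_mul (memLp_mulVec Q memLp_prior i)
  have i2 : Integrable (fun x => f (Q *ᵥ x) * x i) (prior n μ v) :=
    hfL.integrable_mul (memLp_prior i)
  rw [integral_sub (i1.const_mul 2) i2, integral_const_mul] at h1
  linarith

end GaussianPrior

/-! ### The projection signal; `ULift` puts its realizations in the universe `u`. -/

section OptimalSignal

variable {n : ℕ} {μ : ℝ} {v : ℝ≥0}

/-- The noiseless public signal that reveals `Q x`. -/
noncomputable def projectionSignal (Q : Matrix (Fin n) (Fin n) ℝ) :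
    Kernel (Profile n) (ULift.{u} (Profile n)) :=
  Kernel.deterministic (fun x => ULift.up (Q *ᵥ x))
    (measurable_up.comp (measurable_mulVec Q))

instance instIsMarkovKernelProjectionSignal (Q : Matrix (Fin n) (Fin n) ℝ) :
    IsMarkovKernel (projectionSignal.{u} Q) := by
  unfold projectionSignal; infer_instance

lemma measurePreserving_projectionSignal {P : Measure (Profile n)} [IsProbabilityMeasure P]
    (Q : Matrix (Fin n) (Fin n) ℝ) :
    MeasurePreserving (fun x => (x, ULift.up.{u} (Q *ᵥ x))) P (P ⊗ₘ projectionSignal Q) :=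
  ⟨measurable_id.prodMk (measurable_up.comp (measurable_mulVec Q)), by
    rw [projectionSignal, Measure.compProd_deterministic]⟩

lemma integral_projectionSignal {P : Measure (Profile n)} [IsProbabilityMeasure P]
    (Q : Matrix (Fin n) (Fin n) ℝ) {f : Profile n × ULift.{u} (Profile n) → ℝ}
    (hf : Measurable f) :
    ∫ q, f q ∂(P ⊗ₘ projectionSignal Q) = ∫ x, f (x, ULift.up (Q *ᵥ x)) ∂P := by
  rw [← (measurePreserving_projectionSignal.{u} Q).map_eq,
    integral_map (measurePreserving_projectionSignal.{u} Q).aemeasurable hf.aestronglyMeasurable]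

lemma ae_projectionSignal {P : Measure (Profile n)} [IsProbabilityMeasure P]
    (Q : Matrix (Fin n) (Fin n) ℝ) :
    ∀ᵐ q ∂(P ⊗ₘ projectionSignal.{u} Q), q.2.down = Q *ᵥ q.1 := by
  have hs : MeasurableSet {q : Profile n × ULift.{u} (Profile n) | q.2.down = Q *ᵥ q.1} :=
    measurableSet_eq_fun (measurable_down.comp measurable_snd)
      ((measurable_mulVec Q).comp measurable_fst)
  rw [← (measurePreserving_projectionSignal.{u} Q).map_eq,
    ae_map_iff (measurePreserving_projectionSignal.{u} Q).aemeasurable hs]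
  exact .of_forall fun _ => rfl

/-- Let `f` be a coordinate of posterior mean minus `Q x`, a function of the realization. Then `E f
x_i` equals both `E f y_i` and `E f (Qx)_i`, so `E f² = 0`. -/
lemma posteriorMean_projectionSignal {Q : Matrix (Fin n) (Fin n) ℝ} (hQ : Qᵀ = Q)
    (hQQ : Q * Q = Q) (hQ1 : Q *ᵥ (fun _ => 1) = fun _ => 1) :
    ∀ᵐ q ∂(prior n μ v ⊗ₘ projectionSignal.{u} Q),
      posteriorMean (prior n μ v) (projectionSignal.{u} Q) q.2 = Q *ᵥ q.1 := by
  set P := prior n μ v with hPdef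
  have hP : ∀ i, MemLp (fun x : Profile n => x i) 2 P := memLp_prior
  have hY := memLp_posteriorMean (φ := projectionSignal.{u} Q) hP
  have hQx := memLp_mulVec Q (memLp_fst (φ := projectionSignal.{u} Q) hP)
  have hD : ∀ i, MemLp (fun q : Profile n × ULift.{u} (Profile n) => q.2.down i) 2
      (P ⊗ₘ projectionSignal.{u} Q) := fun i =>
    (hQx i).ae_eq ((ae_projectionSignal Q).mono fun q hq => by simp only [hq])
  suffices h : ∀ᵐ q ∂(P ⊗ₘ projectionSignal.{u} Q), ∀ i,
      posteriorMean P (projectionSignal.{u} Q) q.2 i = q.2.down i by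
    filter_upwards [h, ae_projectionSignal Q] with q h1 h2
    rw [← h2]
    exact funext h1
  rw [ae_all_iff]
  intro i
  let f : ULift.{u} (Profile n) → ℝ := fun m =>
    posteriorMean P (projectionSignal.{u} Q) m i - m.down i
  have hdown : Measurable fun m : ULift.{u} (Profile n) => m.down i :=
    (measurable_pi_apply i).comp measurable_down
  have hf : Measurable f :=
    ((measurable_pi_apply i).comp measurable_posteriorMean).sub hdown
  have hfL : MemLp (fun q : Profile n × ULift.{u} (Profile n) => f q.2) 2
      (P ⊗ₘ projectionSignal.{u} Q) := (hY i).sub (hD i)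
  have h1 := integral_mul_fst_eq hf hfL hP i
  have hproj := integral_projection_prior (μ := μ) (v := v) hQ hQQ hQ1
    (f := fun x => f (ULift.up x)) (hf.comp measurable_up)
    (hfL.comp_measurePreserving (measurePreserving_projectionSignal Q)) i
  rw [integral_projectionSignal Q (by fun_prop)] at h1
  have h2 : ∫ q : Profile n × ULift.{u} (Profile n), f q.2 * q.2.down i
      ∂(P ⊗ₘ projectionSignal.{u} Q) = ∫ x, f (ULift.up (Q *ᵥ x)) * (Q *ᵥ x) i ∂P :=
    integral_projectionSignal Q
      ((hf.comp measurable_snd).mul (hdown.comp measurable_snd))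
  have h3 : ∫ q : Profile n × ULift.{u} (Profile n), f q.2 ^ 2
      ∂(P ⊗ₘ projectionSignal.{u} Q) = 0 := by
    have e : ∀ q : Profile n × ULift.{u} (Profile n), f q.2 ^ 2 =
        f q.2 * posteriorMean P (projectionSignal.{u} Q) q.2 i - f q.2 * q.2.down i := by
      intro q
      simp only [f]
      ring
    simp only [e]
    rw [integral_sub (by exact hfL.integrable_mul (hY i)) (by exact hfL.integrable_mul (hD i)),
      ← h1, h2, hproj, sub_self]
  have h4 := (integral_eq_zero_iff_of_nonneg (fun _ => sq_nonneg _) hfL.integrable_sq).mp h3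
  filter_upwards [h4] with q hq
  exact sub_eq_zero.mp (pow_eq_zero_iff two_ne_zero |>.mp hq)

end OptimalSignal

/-! ### The upper bound and its equality case. -/

section Optimality

variable {n : ℕ} {M : Type*} [MeasurableSpace M] {P : Measure (Profile n)}
  [IsProbabilityMeasure P] {φ : Kernel (Profile n) M} [IsMarkovKernel φ]

/-- The expected payoff falls short of the bound `-E|x|² + E xᵀ Wp x` at least by the loss in the
quadratic form of a positive semidefinite `Wp` that dominates the value matrix. -/
lemma expectedPayoff_add_loss_le (G Gt : SimpleGraph (Fin n)) [DecidableRel G.Adj]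
    [DecidableRel Gt.Adj] {β : ℝ} (hβ : 0 ≤ β)
    (hP : ∀ i, MemLp (fun x : Profile n => x i) 2 P) {Wp : Matrix (Fin n) (Fin n) ℝ}
    (hWp : Wp.PosSemidef) (hle : (Wp - valueMatrix G Gt β).PosSemidef) {a : M → Profile n}
    (ha : IsEquilibrium (G.adjMatrix ℝ) β P φ a) :
    expectedPayoff (Gt.adjMatrix ℝ) β P φ a +
        ∫ q, (q.1 - posteriorMean P φ q.2) ⬝ᵥ (Wp *ᵥ (q.1 - posteriorMean P φ q.2)) ∂(P ⊗ₘ φ) ≤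
      -∫ x, x ⬝ᵥ x ∂P + ∫ x, x ⬝ᵥ (Wp *ᵥ x) ∂P := by
  have hY := memLp_posteriorMean (φ := φ) hP
  have hmono : ∫ q, posteriorMean P φ q.2 ⬝ᵥ (valueMatrix G Gt β *ᵥ posteriorMean P φ q.2)
        ∂(P ⊗ₘ φ) ≤
      ∫ q, posteriorMean P φ q.2 ⬝ᵥ (Wp *ᵥ posteriorMean P φ q.2) ∂(P ⊗ₘ φ) := by
    refine integral_mono (integrable_dotProduct hY (memLp_mulVec _ hY))
      (integrable_dotProduct hY (memLp_mulVec _ hY)) fun q => ?_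
    have h := hle.dotProduct_mulVec_nonneg (posteriorMean P φ q.2)
    rw [star_trivial, sub_mulVec, dotProduct_sub] at h
    exact sub_nonneg.mp h
  rw [expectedPayoff_eq G Gt hβ hP ha,
    integral_quadratic_sub hP (by simpa [IsHermitian] using hWp.isHermitian)]
  linarith

lemma informs_averageState (hP : ∀ i, MemLp (fun x : Profile n => x i) 2 P)
    (h : ∀ᵐ q ∂(P ⊗ₘ φ), ∑ i, posteriorMean P φ q.2 i = ∑ i, q.1 i) :
    Informs P φ averageState := by
  filter_upwards [h, ae_compProd_of_ae_comp (memLp_posterior hP)] with q hq hm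
  have hx : ∀ i ∈ Finset.univ, Integrable (fun x : Profile n => x i) (posterior φ P q.2) :=
    fun i _ => (hm i).integrable one_le_two
  refine ⟨(integrable_finsetSum _ hx).const_mul _, ?_⟩
  simp only [averageState]
  rw [integral_const_mul, integral_finsetSum _ hx, ← hq]
  rfl

end Optimality

lemma exists_equilibrium {n : ℕ} {M : Type*} [MeasurableSpace M] {P : Measure (Profile n)}
    [IsProbabilityMeasure P] (φ : Kernel (Profile n) M) [IsMarkovKernel φ]
    (G : SimpleGraph (Fin n)) [DecidableRel G.Adj] {β : ℝ} (hβ : 0 ≤ β)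
    (hP : ∀ i, MemLp (fun x : Profile n => x i) 2 P) :
    IsEquilibrium (G.adjMatrix ℝ) β P φ
      fun m => (bestResponseMatrix G β)⁻¹ *ᵥ posteriorMean P φ m := by
  rw [isEquilibrium_iff G hβ hP]
  refine ⟨(measurable_mulVec _).comp measurable_posteriorMean, .of_forall fun m => ?_⟩
  rw [mulVec_mulVec, mul_nonsing_inv _ (bestResponseMatrix_isUnit_det G hβ), one_mulVec]

end AdaptiveOrg

open AdaptiveOrg Matrix in
theorem proposition1 (n : ℕ) (hn : 1 ≤ n) (μ : ℝ) (v : ℝ≥0) (hv : 0 < v)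
    (G Gt : SimpleGraph (Fin n)) [DecidableRel G.Adj] [DecidableRel Gt.Adj]
    (β : ℝ) (hβ : 0 ≤ β) :
    (∃ (M : Type u) (_ : MeasurableSpace M) (φ : Kernel (AdaptiveOrg.Profile n) M)
      (_ : IsMarkovKernel φ),
        AdaptiveOrg.IsOptimal (G.adjMatrix ℝ) (Gt.adjMatrix ℝ) β (AdaptiveOrg.prior n μ v) φ) ∧
    (∀ (M : Type u) [MeasurableSpace M] (φ : Kernel (AdaptiveOrg.Profile n) M)
      [IsMarkovKernel φ],
        AdaptiveOrg.IsOptimal (G.adjMatrix ℝ) (Gt.adjMatrix ℝ) β (AdaptiveOrg.prior n μ v) φ →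
          AdaptiveOrg.Informs (AdaptiveOrg.prior n μ v) φ AdaptiveOrg.averageState) := by
  obtain ⟨Q, Wp, hQ, hQQ, hQ1, hWp, hle, hWp1, hQW⟩ := exists_positive_part
    (valueMatrix_transpose G Gt (β := β)) (valueMatrix_mulVec_one G Gt hβ)
  have hP : ∀ i, MemLp (fun x : Profile n => x i) 2 (prior n μ v) := memLp_prior
  have hloss : ∀ {M : Type u} [MeasurableSpace M] (φ : Kernel (Profile n) M) [IsMarkovKernel φ]
      (q : Profile n × M), 0 ≤ (q.1 - posteriorMean (prior n μ v) φ q.2) ⬝ᵥ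
        (Wp *ᵥ (q.1 - posteriorMean (prior n μ v) φ q.2)) := fun φ _ q => by
    simpa using hWp.dotProduct_mulVec_nonneg (q.1 - posteriorMean (prior n μ v) φ q.2)
  have heq := exists_equilibrium (projectionSignal.{u} Q) G hβ hP
  have hval := expectedPayoff_eq G Gt hβ hP heq
  have hquad : ∫ q, posteriorMean (prior n μ v) (projectionSignal.{u} Q) q.2 ⬝ᵥ
      (valueMatrix G Gt β *ᵥ posteriorMean (prior n μ v) (projectionSignal.{u} Q) q.2)
        ∂(prior n μ v ⊗ₘ projectionSignal.{u} Q) = ∫ x, x ⬝ᵥ (Wp *ᵥ x) ∂(prior n μ v) := by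
    rw [← integral_compProd_fst (φ := projectionSignal.{u} Q)
      (integrable_dotProduct hP (memLp_mulVec Wp hP)).aestronglyMeasurable]
    refine integral_congr_ae ?_
    filter_upwards [posteriorMean_projectionSignal hQ hQQ hQ1] with q hq
    rw [hq, ← hQW, ← mulVec_mulVec, ← mulVec_mulVec, dotProduct_mulVec q.1 Q, ← mulVec_transpose,
      hQ]
  rw [hquad] at hval
  refine ⟨⟨_, inferInstance, projectionSignal.{u} Q, inferInstance, _, heq, ?_⟩, ?_⟩
  · intro M' _ ψ _ b hb
    rw [hval]
    exact (le_add_of_nonneg_right (integral_nonneg (hloss ψ))).trans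
      (expectedPayoff_add_loss_le G Gt hβ hP hWp hle hb)
  · rintro M _ φ _ ⟨a, ha, hopt⟩
    -- Comparison with the projection signal forces the payoff up to the bound, so the nonnegative
    -- loss in `hbound` integrates to zero.
    have hmax := hopt _ _ _ heq
    rw [hval] at hmax
    have hbound := expectedPayoff_add_loss_le G Gt hβ hP hWp hle ha
    have hdiff : ∀ i, MemLp (fun q : Profile n × M =>
        (q.1 - posteriorMean (prior n μ v) φ q.2) i) 2 (prior n μ v ⊗ₘ φ) := fun i =>
      (memLp_fst hP i).sub (memLp_posteriorMean hP i)
    have hzero := (integral_eq_zero_iff_of_nonneg (hloss φ)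
      (integrable_dotProduct hdiff (memLp_mulVec Wp hdiff))).mp
      (le_antisymm (by linarith) (integral_nonneg (hloss φ)))
    refine informs_averageState hP (hzero.mono fun q hq => ?_)
    -- For a positive semidefinite matrix, a zero of the quadratic form lies in the kernel.
    have hker := (hWp.dotProduct_mulVec_zero_iff (q.1 - posteriorMean (prior n μ v) φ q.2)).mp
      (by simpa using hq)
    have hsum : (fun _ => 1) ⬝ᵥ (q.1 - posteriorMean (prior n μ v) φ q.2) = 0 := by
      have hWt : Wpᵀ = Wp := by simpa [IsHermitian] using hWp.isHermitian
      rw [← hWp1, ← hWt, mulVec_transpose, ← dotProduct_mulVec, hker, dotProduct_zero]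
    simp only [dotProduct, one_mul, Pi.sub_apply, Finset.sum_sub_distrib] at hsum
    linarith
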